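/- Let $n,k,r$ be nonnegative integers with $r\ge 2$, $n\ge 1$ and $k\le n$. For $d\ge 1$ let $$e_d(\mathbf{x}_n^r)=\sum_{1\le i_1<\cdots<i_d\le n}x_{i_1}^r\cdots x_{i_d}^r\in\mathbb{C}[x_1,\dots,x_n],$$ and define the homogeneous ideals $$I_{n,k}=\langle x_1^{kr+1},\dots,x_n^{kr+1},\ e_n(\mathbf{x}_n^r),e_{n-1}(\mathbf{x}_n^r),\dots,e_{n-k+1}(\mathbf{x}_n^r)\rangle,$$ $$J_{n,k}=\langle x_1^{kr},\dots,x_n^{kr},\ e_n(\mathbf{x}_n^r),e_{n-1}(\mathbf{x}_n^r),\dots,e_{n-k+1}(\mathbf{x}_n^r)\rangle$$ and the graded quotients $R_{n,k}=\mathbb{C}[x_1,\dots,x_n]/I_{n,k}$ and $S_{n,k}=\mathbb{C}[x_1,\dots,x_n]/J_{n,k}$. For a graded complex vector space $V=\bigoplus_{d\ge 0}V_d$ with finite-dimensional pieces, let $\mathrm{Hilb}(V;q)=\sum_{d\ge 0}\dim(V_d)\,q^d$. Write $[m]_q=1+q+\cdots+q^{m-1}$ and $[m]!_q=[m]_q[m-1]_q\cdots[1]_q$,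 and define the $q$-Stirling numbers by $\mathrm{Stir}_q(m,j)=[j]_q\,\mathrm{Stir}_q(m-1,j)+\mathrm{Stir}_q(m-1,j-1)$ for $m,j\ge 1$, $\mathrm{Stir}_q(0,j)=\delta_{0,j}$ and $\mathrm{Stir}_q(m,0)=0$ for $m\ge 1$. Let $\mathrm{rev}_q$ be the operator reversing the coefficient sequence of a polynomial in $q$, that is, $\mathrm{rev}_q(f)(q)=q^{\deg f}f(q^{-1})$ for $f\neq 0$ and $\mathrm{rev}_q(0)=0$. Then $$\begin{aligned} \mathrm{Hilb}(R_{n,k};q)&=\sum_{z=0}^{n}\binom{n}{z}q^{krz}\cdot\mathrm{rev}_q\bigl([r]_q^{\,n-z}\cdot[k]!_{q^r}\cdot\mathrm{Stir}_{q^r}(n-z,k)\bigr)\\ &=\sum_{z=0}^{n}\binom{n}{z}q^{krz}\cdot[r]_q^{\,n-z}\cdot[k]!_{q^r}\cdot\mathrm{rev}_q\bigl(\mathrm{Stir}_{q^r}(n-z,k)\bigr),\\ \mathrm{Hilb}(S_{n,k};q)&=\mathrm{rev}_q\bigl([r]_q^{\,n}\cdot[k]!_{q^r}\cdot\mathrm{Stir}_{q^r}(n,k)\bigr)\\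 &=[r]_q^{\,n}\cdot[k]!_{q^r}\cdot\mathrm{rev}_q\bigl(\mathrm{Stir}_{q^r}(n,k)\bigr). \end{aligned}$$ -/

import Mathlib

namespace WreathCoinvariant

/-- The `q`-integer `[m]_q = 1 + q + ⋯ + q^(m-1)`. -/
def qInt {A : Type*} [CommSemiring A] (q : A) (m : ℕ) : A :=
  ∑ i ∈ Finset.range m, q ^ i

/-- The `q`-factorial `[m]!_q = [m]_q [m-1]_q ⋯ [1]_q`. -/
def qFactorial {A : Type*} [CommSemiring A] (q : A) (m : ℕ) : A :=
  ∏ i ∈ Finset.range m, qInt q (i + 1)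

/-- The `q`-Stirling numbers `Stir_q(n,k)`: `Stir_q(0,k) = δ_{0,k}`, `Stir_q(n,0) = 0` for `n ≥ 1`, and
`Stir_q(n,k) = [k]_q Stir_q(n-1,k) + Stir_q(n-1,k-1)` for `n, k ≥ 1`. -/
def qStirling {A : Type*} [CommSemiring A] (q : A) : ℕ → ℕ → A
  | 0, 0 => 1
  | 0, _ + 1 => 0
  | _ + 1, 0 => 0
  | n + 1, k + 1 => qInt q (k + 1) * qStirling q n (k + 1) + qStirling q n k

/-- The polynomial `e_d(x_1^r, …, x_n^r)`, the `d`-th elementary symmetric function in the variable powers. -/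
noncomputable def esymmPow (r n d : ℕ) : MvPolynomial (Fin n) ℂ :=
  ∑ s ∈ Finset.powersetCard d (Finset.univ : Finset (Fin n)), ∏ i ∈ s, MvPolynomial.X i ^ r

/-- The ideal of `ℂ[x_1, …, x_n]` generated by `x_1^m, …, x_n^m` together with
`e_n(x^r), e_{n-1}(x^r), …, e_{n-k+1}(x^r)`. -/
noncomputable def powerIdeal (r n k m : ℕ) : Ideal (MvPolynomial (Fin n) ℂ) :=
  Ideal.span (Set.range (fun i : Fin n => (MvPolynomial.X i : MvPolynomial (Fin n) ℂ) ^ m) ∪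
    esymmPow r n '' Set.Icc (n - k + 1) n)

/-- The ideal `I_{n,k} = ⟨x_1^(kr+1), …, x_n^(kr+1), e_n(x^r), …, e_{n-k+1}(x^r)⟩`. -/
noncomputable def idealI (r n k : ℕ) : Ideal (MvPolynomial (Fin n) ℂ) :=
  powerIdeal r n k (k * r + 1)

/-- The ideal `J_{n,k} = ⟨x_1^(kr), …, x_n^(kr), e_n(x^r), …, e_{n-k+1}(x^r)⟩`. -/
noncomputable def idealJ (r n k : ℕ) : Ideal (MvPolynomial (Fin n) ℂ) :=
  powerIdeal r n k (k * r)

/-- The ring `R_{n,k} = ℂ[x_1, …, x_n] / I_{n,k}`. -/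
abbrev RingR (r n k : ℕ) : Type := MvPolynomial (Fin n) ℂ ⧸ idealI r n k

/-- The ring `S_{n,k} = ℂ[x_1, …, x_n] / J_{n,k}`. -/
abbrev RingS (r n k : ℕ) : Type := MvPolynomial (Fin n) ℂ ⧸ idealJ r n k

/-- The degree `d` part of `ℂ[x_1, …, x_n] / I`: the image of the homogeneous polynomials of degree `d`. -/
noncomputable def gradedPart {n : ℕ} (I : Ideal (MvPolynomial (Fin n) ℂ)) (d : ℕ) :
    Submodule ℂ (MvPolynomial (Fin n) ℂ ⧸ I) :=
  (MvPolynomial.homogeneousSubmodule (Fin n) ℂ d).map (Ideal.Quotient.mkₐ ℂ I).toLinearMap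

/-- The Hilbert series `∑_d dim(V_d) q^d` of a family `(V_d)` of subspaces of a complex vector space. -/
noncomputable def hilbertSeries {V : Type*} [AddCommGroup V] [Module ℂ V] (𝒱 : ℕ → Submodule ℂ V) :
    PowerSeries ℤ :=
  PowerSeries.mk fun d => (Module.finrank ℂ (𝒱 d) : ℤ)

/-- `Hilb(R_{n,k}; q)`. -/
noncomputable def hilbR (r n k : ℕ) : PowerSeries ℤ :=
  hilbertSeries (V := RingR r n k) (gradedPart (idealI r n k))

/-- `Hilb(S_{n,k}; q)`. -/
noncomputable def hilbS (r n k : ℕ) : PowerSeries ℤ :=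
  hilbertSeries (V := RingS r n k) (gradedPart (idealJ r n k))

theorem esymmPow_isHomogeneous (r n d : ℕ) : (esymmPow r n d).IsHomogeneous (d * r) := by
  refine MvPolynomial.IsHomogeneous.sum _ _ _ fun s hs => ?_
  rw [← (Finset.mem_powersetCard.1 hs).2, ← smul_eq_mul, ← Finset.sum_const]
  exact MvPolynomial.IsHomogeneous.prod _ _ _ fun i _ => MvPolynomial.isHomogeneous_X_pow i r

section

attribute [local instance] MvPolynomial.gradedAlgebra

/-- The ideals `I_{n,k}` and `J_{n,k}` are homogeneous, so their quotients are graded by `gradedPart`. -/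
theorem powerIdeal_isHomogeneous (r n k m : ℕ) :
    (powerIdeal r n k m).IsHomogeneous (MvPolynomial.homogeneousSubmodule (Fin n) ℂ) := by
  refine Ideal.homogeneous_span _ _ ?_
  rintro _ (⟨i, rfl⟩ | ⟨d, _, rfl⟩)
  · exact ⟨m, MvPolynomial.isHomogeneous_X_pow i m⟩
  · exact ⟨d * r, esymmPow_isHomogeneous r n d⟩

end

/-- The graded parts of the quotient are finite-dimensional. -/
instance gradedPart_finite {n : ℕ} (I : Ideal (MvPolynomial (Fin n) ℂ)) (d : ℕ) :
    Module.Finite ℂ (gradedPart I d) := by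
  have h : MvPolynomial.homogeneousSubmodule (Fin n) ℂ d ≤
      MvPolynomial.restrictTotalDegree (Fin n) ℂ d := fun p hp =>
    (MvPolynomial.mem_restrictTotalDegree _ _ _).2 (MvPolynomial.IsHomogeneous.totalDegree_le hp)
  have : Module.Finite ℂ (MvPolynomial.homogeneousSubmodule (Fin n) ℂ d) :=
    Submodule.finiteDimensional_of_le h
  unfold gradedPart
  infer_instance

end WreathCoinvariant

/-!
For the upper bound on the Hilbert series let the exponents of the powers of the variables vary. If
`f` is a form of degree `e`, the exact sequence `R/(I : f) → R/I → R/(I + (f)) → 0`, whose first map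
is multiplication by `f`, bounds the series of `R/I` by that of `R/(I + (f))` plus `q ^ e` times
that of `R/(I : f)`. Taking for `f` a power of a variable removes that variable, and taking for `f`
the next elementary symmetric polynomial changes `k`; this reproduces the recursion of the
`q`-Stirling numbers.

For the lower bound fix `k` distinct nonzero values, and let `Y ⊆ ℂ ^ n` be the set of words `y`
whose letters are `r`-th roots of these values (or also `0`, in the case of `R_{n,k}`) such that
every value occurs among the `y_i ^ r`. The generators of the ideal are top-degree forms of
polynomials that vanish on `Y`, so the quotient has dimension at least `#Y`. The number of such
words is a `k`-th forward difference of `x ↦ x ^ n`, which is the value of the upper bound at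
`q = 1`; hence the two bounds agree in every degree.
-/

namespace WreathCoinvariant

section Reversal

open Polynomial

theorem qInt_zero {A : Type*} [CommSemiring A] (q : A) : qInt q 0 = 0 :=
  Finset.sum_range_zero _

theorem qInt_succ {A : Type*} [CommSemiring A] (q : A) (m : ℕ) :
    qInt q (m + 1) = qInt q m + q ^ m :=
  Finset.sum_range_succ _ m

theorem qInt_one {A : Type*} [CommSemiring A] (q : A) : qInt q 1 = 1 := by
  rw [qInt_succ, qInt_zero, zero_add, pow_zero]

theorem qInt_add {A : Type*} [CommSemiring A] (q : A) (a b : ℕ) :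
    qInt q (a + b) = qInt q a + q ^ a * qInt q b := by
  simp only [qInt, Finset.sum_range_add, Finset.mul_sum, pow_add]

theorem qInt_mul {A : Type*} [CommSemiring A] (q : A) (a r : ℕ) :
    qInt q (a * r) = qInt q r * qInt (q ^ r) a := by
  induction a with
  | zero => rw [zero_mul, qInt_zero, qInt_zero, mul_zero]
  | succ a ih => rw [add_one_mul, qInt_add, ih, qInt_succ, ← pow_mul, mul_comm r a]; ring

theorem qFactorial_succ {A : Type*} [CommSemiring A] (q : A) (m : ℕ) :
    qFactorial q (m + 1) = qFactorial q m * qInt q (m + 1) :=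
  Finset.prod_range_succ _ m

theorem qStirling_eq_zero_of_lt {A : Type*} [CommSemiring A] (q : A) {n k : ℕ} (h : n < k) :
    qStirling q n k = 0 := by
  induction n generalizing k with
  | zero =>
    obtain ⟨k, rfl⟩ := Nat.exists_eq_add_of_le' h
    rfl
  | succ n ih =>
    obtain ⟨k, rfl⟩ := Nat.exists_eq_add_of_le' (show 1 ≤ k by lia)
    rw [qStirling, ih (by lia), ih (by lia), mul_zero, add_zero]

theorem qStirling_self {A : Type*} [CommSemiring A] (q : A) (n : ℕ) : qStirling q n n = 1 := by
  induction n with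
  | zero => rfl
  | succ n ih =>
    rw [qStirling, qStirling_eq_zero_of_lt q (Nat.lt_succ_self n), ih, mul_zero, zero_add]

variable {r : ℕ}

theorem isMonicOfDegree_qInt_X_pow (hr : 0 < r) (m : ℕ) :
    IsMonicOfDegree (qInt (X ^ r : ℤ[X]) (m + 1)) (r * m) := by
  induction m with
  | zero => simp [qInt_one, isMonicOfDegree_zero_iff]
  | succ m ih =>
    rw [qInt_succ, ← pow_mul]
    refine IsMonicOfDegree.add_left ?_ (isMonicOfDegree_X_pow ℤ _)
    rw [ih.natDegree_eq]
    exact Nat.mul_lt_mul_of_pos_left m.lt_succ_self hr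

theorem isMonicOfDegree_qStirling_X_pow (hr : 0 < r) {n k : ℕ} (hk : k ≤ n) :
    IsMonicOfDegree (qStirling (X ^ r : ℤ[X]) (n + 1) (k + 1)) (r * (k * (n - k))) := by
  induction n generalizing k with
  | zero =>
    obtain rfl := Nat.le_zero.1 hk
    simp [qStirling_self, isMonicOfDegree_zero_iff]
  | succ n ih =>
    rcases hk.eq_or_lt with rfl | hk
    · simp [qStirling_self, isMonicOfDegree_zero_iff]
    obtain ⟨c, rfl⟩ := Nat.exists_eq_add_of_le (Nat.lt_succ_iff.1 hk)
    have hmain := (isMonicOfDegree_qInt_X_pow hr k).mul (ih (Nat.le_add_right k c))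
    have hdeg : r * k + r * (k * (k + c - k)) = r * (k * (k + c + 1 - k)) := by
      rw [show k + c + 1 - k = c + 1 by lia, Nat.add_sub_cancel_left]
      ring
    rw [hdeg] at hmain
    rw [qStirling]
    cases k with
    | zero => rwa [qStirling, add_zero]
    | succ k =>
      refine hmain.add_right ?_
      rw [(ih (show k ≤ k + 1 + c by lia)).natDegree_eq, show k + 1 + c - k = c + 1 by lia,
        show k + 1 + c + 1 - (k + 1) = c + 1 by lia]
      gcongr
      exact k.lt_succ_self

theorem reflect_add_left {f : ℤ[X]} {N : ℕ} (h : f.natDegree ≤ N) (c : ℕ) :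
    reflect (N + c) f = X ^ c * reflect N f := by
  have := reflect_mul f 1 h (natDegree_one.le.trans c.zero_le)
  rwa [mul_one, reflect_one, mul_comm] at this

theorem reverse_qInt_X_pow (hr : 0 < r) (m : ℕ) :
    reverse (qInt (X ^ r : ℤ[X]) m) = qInt (X ^ r : ℤ[X]) m := by
  induction m with
  | zero => rw [qInt_zero, reverse_zero]
  | succ m ih =>
    cases m with
    | zero => simpa only [zero_add, qInt_one, map_one] using reverse_C (1 : ℤ)
    | succ m =>
      have hm := isMonicOfDegree_qInt_X_pow hr m
      rw [reverse, hm.natDegree_eq] at ih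
      rw [reverse, (isMonicOfDegree_qInt_X_pow hr (m + 1)).natDegree_eq]
      have hlast : reflect (r * (m + 1)) ((X ^ r : ℤ[X]) ^ (m + 1)) = 1 := by
        rw [← pow_mul, reflect_monomial, revAt_le le_rfl, Nat.sub_self, pow_zero]
      nth_rw 1 [qInt_succ]
      rw [reflect_add, hlast, mul_add_one r m, reflect_add_left hm.natDegree_eq.le, ih,
        add_comm (m + 1) 1, qInt_add _ 1 (m + 1), qInt_one, pow_one, add_comm]

theorem reverse_qFactorial_X_pow (hr : 0 < r) (m : ℕ) :
    reverse (qFactorial (X ^ r : ℤ[X]) m) = qFactorial (X ^ r : ℤ[X]) m := by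
  induction m with
  | zero => simpa only [qFactorial, Finset.prod_range_zero, map_one] using reverse_C (1 : ℤ)
  | succ m ih => rw [qFactorial_succ, reverse_mul_of_domain, ih, reverse_qInt_X_pow hr]

theorem reverse_qInt_pow (r m : ℕ) :
    reverse (qInt (X : ℤ[X]) r ^ m) = qInt (X : ℤ[X]) r ^ m := by
  have hq : reverse (qInt (X : ℤ[X]) r) = qInt X r := by
    simpa only [pow_one] using reverse_qInt_X_pow Nat.one_pos r
  induction m with
  | zero => simpa only [pow_zero, map_one] using reverse_C (1 : ℤ)
  | succ m ih => rw [pow_succ, reverse_mul_of_domain, ih, hq]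

theorem reverse_qStirling_X_pow_succ_succ (hr : 0 < r) (n k : ℕ) :
    reverse (qStirling (X ^ r : ℤ[X]) (n + 1) (k + 1)) =
      qInt (X ^ r) (k + 1) * reverse (qStirling (X ^ r) n (k + 1)) +
        X ^ (r * (n - k)) * reverse (qStirling (X ^ r) n k) := by
  rcases le_or_gt n k with hnk | hkn
  · rw [qStirling, qStirling_eq_zero_of_lt _ (Nat.lt_succ_iff.2 hnk), Nat.sub_eq_zero_of_le hnk]
    simp
  obtain ⟨c, rfl⟩ := Nat.exists_eq_add_of_lt hkn
  have hprod : reverse (qInt (X ^ r : ℤ[X]) (k + 1) * qStirling (X ^ r) (k + c + 1) (k + 1)) =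
      qInt (X ^ r) (k + 1) * reverse (qStirling (X ^ r) (k + c + 1) (k + 1)) := by
    rw [reverse_mul_of_domain, reverse_qInt_X_pow hr]
  cases k with
  | zero => simpa only [qStirling, add_zero, reverse_zero, mul_zero, zero_add] using hprod
  | succ k =>
    have hsum := isMonicOfDegree_qStirling_X_pow hr (show k + 1 ≤ k + 1 + c + 1 by lia)
    have hleft := (isMonicOfDegree_qInt_X_pow hr (k + 1)).mul
      (isMonicOfDegree_qStirling_X_pow hr (show k + 1 ≤ k + 1 + c by lia))
    have hright := isMonicOfDegree_qStirling_X_pow hr (show k ≤ k + 1 + c by lia)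
    have hsub : k + 1 + c + 1 - (k + 1) = c + 1 := by lia
    have hdeg : r * ((k + 1) * (c + 1)) = r * (k * (c + 1)) + r * (c + 1) := by ring
    have hdeg' : r * ((k + 1) * (c + 1)) = r * (k + 1) + r * ((k + 1) * c) := by ring
    rw [show k + 1 + c - (k + 1) = c by lia] at hleft
    rw [show k + 1 + c - k = c + 1 by lia] at hright
    rw [← hprod]
    rw [reverse, reverse, reverse, hsum.natDegree_eq, hleft.natDegree_eq, hright.natDegree_eq, hsub,
      ← reflect_add_left hright.natDegree_eq.le, ← hdeg, ← hdeg', ← reflect_add, qStirling]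

/-- The polynomial `[r]_q ^ n * [k]!_(q^r) * rev_q (Stir_(q^r) (n, k))`, which the theorem claims to
be the Hilbert series of `S_{n,k}`. -/
noncomputable def hilbPolyS (r n k : ℕ) : ℤ[X] :=
  qInt X r ^ n * qFactorial (X ^ r) k * reverse (qStirling (X ^ r) n k)

theorem reverse_eq_hilbPolyS (hr : 0 < r) (n k : ℕ) :
    reverse (qInt X r ^ n * qFactorial (X ^ r) k * qStirling (X ^ r) n k) = hilbPolyS r n k := by
  rw [reverse_mul_of_domain, reverse_mul_of_domain, reverse_qInt_pow, reverse_qFactorial_X_pow hr,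
    hilbPolyS]

theorem hilbPolyS_zero_zero (r : ℕ) : hilbPolyS r 0 0 = 1 := by
  simpa [hilbPolyS, qFactorial, qStirling] using reverse_C (1 : ℤ)

theorem hilbPolyS_eq_zero_of_lt (r : ℕ) {n k : ℕ} (h : n < k) : hilbPolyS r n k = 0 := by
  rw [hilbPolyS, qStirling_eq_zero_of_lt _ h, reverse_zero, mul_zero]

theorem hilbPolyS_succ_zero (r n : ℕ) : hilbPolyS r (n + 1) 0 = 0 := by
  rw [hilbPolyS, qStirling, reverse_zero, mul_zero]

theorem hilbPolyS_succ_succ (hr : 0 < r) (n k : ℕ) :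
    hilbPolyS r (n + 1) (k + 1) =
      qInt X ((k + 1) * r) * (hilbPolyS r n (k + 1) + X ^ (r * (n - k)) * hilbPolyS r n k) := by
  rw [hilbPolyS, reverse_qStirling_X_pow_succ_succ hr, hilbPolyS, hilbPolyS, qInt_mul,
    qFactorial_succ]
  ring

end Reversal

section ForwardDifference

open Polynomial fwdDiff

theorem fwdDiff_iter_succ_const {M G : Type*} [AddCommMonoid M] [AddCommGroup G] (h : M) (a : G)
    (k : ℕ) : Δ_[h] ^[k + 1] (fun _ : M => a) = 0 := by
  induction k with
  | zero => exact fwdDiff_const h a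
  | succ k ih => rw [Function.iterate_succ_apply', ih]; exact fwdDiff_const h 0

theorem fwdDiff_iter_succ_id_mul {R : Type*} [CommRing R] (h : R) (f : R → R) (k : ℕ) (y : R) :
    Δ_[h] ^[k + 1] (fun x => x * f x) y =
      (y + (k + 1) * h) * Δ_[h] ^[k + 1] f y + (k + 1) * h * Δ_[h] ^[k] f y := by
  induction k generalizing y with
  | zero =>
    simp only [zero_add, Function.iterate_one, Function.iterate_zero, id, fwdDiff, Nat.cast_zero]
    ring
  | succ k ih =>
    have hk (g : R → R) (m : ℕ) (z : R) :
        Δ_[h] ^[m + 1] g z = Δ_[h] ^[m] g (z + h) - Δ_[h] ^[m] g z := by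
      rw [Function.iterate_succ_apply', fwdDiff]
    rw [hk _ (k + 1), ih, ih, hk f (k + 1)]
    push_cast
    linear_combination -(k + 1) * h * hk f k y

theorem eval_one_qInt_X (m : ℕ) : (qInt (X : ℤ[X]) m).eval 1 = m := by
  simp [qInt, eval_finsetSum]

theorem eval_one_hilbPolyS {r : ℕ} (hr : 0 < r) (n k : ℕ) :
    (hilbPolyS r n k).eval 1 = Δ_[(r : ℤ)] ^[k] (fun x => x ^ n) 0 := by
  induction n generalizing k with
  | zero =>
    cases k with
    | zero => simp [hilbPolyS_zero_zero]
    | succ k => simp [hilbPolyS_eq_zero_of_lt, fwdDiff_iter_succ_const]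
  | succ n ih =>
    cases k with
    | zero => simp [hilbPolyS_succ_zero]
    | succ k =>
      simp only [hilbPolyS_succ_succ hr, eval_mul, eval_add, eval_pow, eval_X, one_pow, one_mul,
        eval_one_qInt_X, ih, pow_succ', fwdDiff_iter_succ_id_mul]
      push_cast
      ring

theorem fwdDiff_iter_pow_add_one {h : ℤ} (n k : ℕ) (y : ℤ) :
    Δ_[h] ^[k] (fun x => x ^ n) (y + 1) =
      ∑ z ∈ Finset.range (n + 1), n.choose z * Δ_[h] ^[k] (fun x => x ^ (n - z)) y := by
  have hbinom : (fun x : ℤ => (x + 1) ^ n) =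
      ∑ z ∈ Finset.range (n + 1), (n.choose z : ℤ) • fun x : ℤ => x ^ (n - z) := by
    ext x
    rw [add_comm, add_pow, Finset.sum_apply]
    exact Finset.sum_congr rfl fun z _ => by simp [mul_comm]
  rw [← fwdDiff_iter_comp_add, hbinom, fwdDiff_iter_finsetSum, Finset.sum_apply]
  simp only [fwdDiff_iter_const_smul, Pi.smul_apply, smul_eq_mul]

end ForwardDifference

section HilbertBound

open MvPolynomial Module

theorem finrank_map_le_finrank_map {K V V₁ V₂ : Type*} [DivisionRing K] [AddCommGroup V]
    [Module K V] [AddCommGroup V₁] [Module K V₁] [AddCommGroup V₂] [Module K V₂]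
    (W : Submodule K V) [Module.Finite K W] (f : V →ₗ[K] V₁) (g : V →ₗ[K] V₂)
    (h : ∀ p ∈ W, f p = 0 → g p = 0) : finrank K (W.map g) ≤ finrank K (W.map f) := by
  have hf := LinearMap.finrank_range_add_finrank_ker (f.domRestrict W)
  have hg := LinearMap.finrank_range_add_finrank_ker (g.domRestrict W)
  have hker : LinearMap.ker (f.domRestrict W) ≤ LinearMap.ker (g.domRestrict W) :=
    fun p hp => h p p.2 hp
  have := Submodule.finrank_mono hker
  rw [LinearMap.range_domRestrict] at hf hg
  lia

theorem finrank_le_finrank_map_add {K V V₁ : Type*} [DivisionRing K] [AddCommGroup V]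
    [Module K V] [AddCommGroup V₁] [Module K V₁] (W N : Submodule K V) [Module.Finite K W]
    [Module.Finite K N] (f : V →ₗ[K] V₁) (h : ∀ p ∈ W, f p = 0 → p ∈ N) :
    finrank K W ≤ finrank K (W.map f) + finrank K N := by
  have hf := LinearMap.finrank_range_add_finrank_ker (f.domRestrict W)
  have hker : (LinearMap.ker (f.domRestrict W)).map W.subtype ≤ N := by
    rintro _ ⟨p, hp, rfl⟩
    exact h p p.2 hp
  have := Submodule.finrank_mono hker
  rw [Submodule.finrank_map_subtype_eq] at this
  rw [LinearMap.range_domRestrict] at hf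
  lia

instance homogeneousSubmodule_finite {σ K : Type*} [Finite σ] [Field K] (d : ℕ) :
    Module.Finite K (homogeneousSubmodule σ K d) :=
  Submodule.finiteDimensional_of_le (S₂ := restrictTotalDegree σ K d) fun _ hp =>
    (mem_restrictTotalDegree _ _ _).2 (IsHomogeneous.totalDegree_le hp)

variable {n : ℕ} {I : Ideal (MvPolynomial (Fin n) ℂ)}

theorem finrank_map_homogeneousSubmodule_le {V : Type*} [AddCommGroup V] [Module ℂ V] {d : ℕ}
    (g : MvPolynomial (Fin n) ℂ →ₗ[ℂ] V) (h : ∀ p ∈ I, p.IsHomogeneous d → g p = 0) :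
    finrank ℂ ((homogeneousSubmodule (Fin n) ℂ d).map g) ≤ finrank ℂ (gradedPart I d) :=
  finrank_map_le_finrank_map _ _ _ fun p hp hpI => h p (Ideal.Quotient.eq_zero_iff_mem.1 hpI) hp

theorem finrank_gradedPart_le {J : Ideal (MvPolynomial (Fin n) ℂ)} {d : ℕ}
    (h : ∀ p ∈ J, p.IsHomogeneous d → p ∈ I) :
    finrank ℂ (gradedPart I d) ≤ finrank ℂ (gradedPart J d) :=
  finrank_map_homogeneousSubmodule_le _ fun p hp hd =>
    Ideal.Quotient.eq_zero_iff_mem.2 (h p hp hd)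

section Homogeneous

attribute [local instance] MvPolynomial.gradedAlgebra

variable {σ R : Type*} [CommRing R]

theorem homogeneousComponent_add_mul {p : MvPolynomial σ R} {e : ℕ} (hp : p.IsHomogeneous e)
    (q : MvPolynomial σ R) (d : ℕ) :
    homogeneousComponent (d + e) (p * q) = p * homogeneousComponent d q := by
  rw [add_comm d e]
  simp only [← decomposition.decompose'_apply]
  exact DirectSum.coe_decompose_mul_add_of_left_mem (homogeneousSubmodule σ R) hp

theorem homogeneousComponent_mul_of_lt {p : MvPolynomial σ R} {e : ℕ} (hp : p.IsHomogeneous e)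
    (q : MvPolynomial σ R) {d : ℕ} (hd : d < e) : homogeneousComponent d (p * q) = 0 := by
  rw [← decomposition.decompose'_apply]
  exact DirectSum.coe_decompose_mul_of_left_mem_of_not_le (homogeneousSubmodule σ R) hp hd.not_ge

theorem mem_of_mem_sup_span_singleton_of_lt {I : Ideal (MvPolynomial σ R)}
    (hI : I.IsHomogeneous (homogeneousSubmodule σ R)) {f p : MvPolynomial σ R} {e d : ℕ}
    (hf : f.IsHomogeneous e) (hp : p.IsHomogeneous d) (hd : d < e) (hpf : p ∈ I ⊔ Ideal.span {f}) :
    p ∈ I := by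
  obtain ⟨a, ha, b, hb, rfl⟩ := Submodule.mem_sup.1 hpf
  obtain ⟨b, rfl⟩ := Ideal.mem_span_singleton'.1 hb
  have hcomp := homogeneousComponent_eq_self hp
  rw [map_add, mul_comm b f, homogeneousComponent_mul_of_lt hf b hd, add_zero] at hcomp
  rw [mul_comm b f, ← hcomp]
  exact homogeneousComponent_mem_of_mem hI ha d

theorem exists_isHomogeneous_sub_mul_mem {I : Ideal (MvPolynomial σ R)}
    (hI : I.IsHomogeneous (homogeneousSubmodule σ R)) {f p : MvPolynomial σ R} {e d : ℕ}
    (hf : f.IsHomogeneous e) (hp : p.IsHomogeneous (d + e)) (hpf : p ∈ I ⊔ Ideal.span {f}) :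
    ∃ q : MvPolynomial σ R, q.IsHomogeneous d ∧ p - f * q ∈ I := by
  obtain ⟨a, ha, b, hb, rfl⟩ := Submodule.mem_sup.1 hpf
  obtain ⟨b, rfl⟩ := Ideal.mem_span_singleton'.1 hb
  refine ⟨_, homogeneousComponent_isHomogeneous d b, ?_⟩
  rw [← homogeneousComponent_eq_self hp, map_add, mul_comm b f, homogeneousComponent_add_mul hf,
    add_sub_cancel_right]
  exact homogeneousComponent_mem_of_mem hI ha _

theorem finrank_gradedPart_le_add (hI : I.IsHomogeneous (homogeneousSubmodule (Fin n) ℂ))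
    {f : MvPolynomial (Fin n) ℂ} {e : ℕ} (hf : f.IsHomogeneous e) (d : ℕ) :
    finrank ℂ (gradedPart I (d + e)) ≤
      finrank ℂ (gradedPart (I ⊔ Ideal.span {f}) (d + e)) +
        finrank ℂ (gradedPart (I.colon {f}) d) := by
  let factor := (Ideal.Quotient.factorₐ ℂ (le_sup_left : I ≤ I ⊔ Ideal.span {f})).toLinearMap
  let mulf := (Ideal.Quotient.mkₐ ℂ I).toLinearMap ∘ₗ LinearMap.mulLeft ℂ f
  have hfactor : (gradedPart I (d + e)).map factor =
      gradedPart (I ⊔ Ideal.span {f}) (d + e) := by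
    rw [gradedPart, gradedPart, ← Submodule.map_comp]
    rfl
  have hmulf : finrank ℂ ((homogeneousSubmodule (Fin n) ℂ d).map mulf) ≤
      finrank ℂ (gradedPart (I.colon {f}) d) := by
    refine finrank_map_homogeneousSubmodule_le _ fun p hp _ => ?_
    rw [Submodule.mem_colon_singleton, smul_eq_mul, mul_comm] at hp
    exact Ideal.Quotient.eq_zero_iff_mem.2 hp
  refine (finrank_le_finrank_map_add _ ((homogeneousSubmodule (Fin n) ℂ d).map mulf) factor
    ?_).trans (hfactor ▸ Nat.add_le_add_left hmulf _)
  rintro _ ⟨p, hp, rfl⟩ hpf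
  obtain ⟨q, hq, hpq⟩ :=
    exists_isHomogeneous_sub_mul_mem hI hf hp (Ideal.Quotient.eq_zero_iff_mem.1 hpf)
  exact ⟨q, hq, (Ideal.Quotient.eq.2 hpq).symm⟩

/-- Coefficientwise, the Hilbert series of the quotient by `I` is at most the polynomial `P`. -/
def HilbertBound (I : Ideal (MvPolynomial (Fin n) ℂ)) (P : Polynomial ℤ) : Prop :=
  ∀ d, (finrank ℂ (gradedPart I d) : ℤ) ≤ P.coeff d

namespace HilbertBound

variable {P Q : Polynomial ℤ}

theorem anti {J : Ideal (MvPolynomial (Fin n) ℂ)} (hI : HilbertBound I P) (h : I ≤ J) :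
    HilbertBound J P := fun d =>
  (Nat.cast_le.2 (finrank_gradedPart_le fun _ hp _ => h hp)).trans (hI d)

theorem top : HilbertBound (⊤ : Ideal (MvPolynomial (Fin n) ℂ)) 0 := by
  intro d
  have : Subsingleton (MvPolynomial (Fin n) ℂ ⧸ (⊤ : Ideal (MvPolynomial (Fin n) ℂ))) :=
    Ideal.Quotient.subsingleton_iff.2 rfl
  simp [Subsingleton.elim (gradedPart ⊤ d) ⊥]

theorem one_of_isEmpty (I : Ideal (MvPolynomial (Fin 0) ℂ)) : HilbertBound I 1 := by
  intro d
  rw [Polynomial.coeff_one]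
  split_ifs with hd
  · subst hd
    have hone : finrank ℂ (homogeneousSubmodule (Fin 0) ℂ 0) = 1 := by
      rw [homogeneousSubmodule_zero, Submodule.one_eq_span, finrank_span_singleton one_ne_zero]
    exact_mod_cast (Submodule.finrank_map_le _ _).trans hone.le
  · have : gradedPart I d = ⊥ := by
      refine (Submodule.eq_bot_iff _).2 ?_
      rintro _ ⟨p, hp, rfl⟩
      by_contra hne
      have hp0 : p ≠ 0 := fun h => hne (by rw [h, map_zero])
      exact hd (hp.inj_right (isHomogeneous_of_isEmpty (Fin 0) ℂ p) hp0)
    rw [this, finrank_bot, Nat.cast_zero]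

theorem of_colon (hI : I.IsHomogeneous (homogeneousSubmodule (Fin n) ℂ))
    {f : MvPolynomial (Fin n) ℂ} {e : ℕ} (hf : f.IsHomogeneous e)
    (hP : HilbertBound (I ⊔ Ideal.span {f}) P) (hQ : HilbertBound (I.colon {f}) Q) :
    HilbertBound I (P + Polynomial.X ^ e * Q) := by
  intro d
  rw [Polynomial.coeff_add, Polynomial.coeff_X_pow_mul']
  split_ifs with hd
  · obtain ⟨c, rfl⟩ := Nat.exists_eq_add_of_le' hd
    rw [Nat.add_sub_cancel]
    have := finrank_gradedPart_le_add hI hf c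
    have := hP (c + e)
    have := hQ c
    lia
  · rw [add_zero]
    refine le_trans (Nat.cast_le.2 (finrank_gradedPart_le fun p hp hd' => ?_)) (hP d)
    exact mem_of_mem_sup_span_singleton_of_lt hI hf hd' (not_le.1 hd) hp

end HilbertBound

end Homogeneous

theorem gradedPart_le_map_rename_succAbove {I : Ideal (MvPolynomial (Fin (n + 1)) ℂ)}
    {i : Fin (n + 1)} (hi : X i ∈ I) (d : ℕ) :
    gradedPart I d ≤ (homogeneousSubmodule (Fin n) ℂ d).map
      ((Ideal.Quotient.mkₐ ℂ I).comp (rename i.succAbove)).toLinearMap := by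
  let v : Fin (n + 1) → MvPolynomial (Fin n) ℂ := i.insertNth 0 X
  have hv (j : Fin (n + 1)) : (v j).IsHomogeneous 1 := by
    refine Fin.succAboveCases i ?_ (fun l => ?_) j
    · simpa [v] using isHomogeneous_zero (Fin n) ℂ 1
    · simpa [v] using isHomogeneous_X ℂ l
  have hmk : ((Ideal.Quotient.mkₐ ℂ I).comp (rename i.succAbove)).comp (aeval v) =
      Ideal.Quotient.mkₐ ℂ I := by
    refine algHom_ext fun j => Fin.succAboveCases i ?_ (fun l => ?_) j
    · simpa [v] using (Ideal.Quotient.eq_zero_iff_mem.2 hi).symm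
    · simp [v]
  rintro _ ⟨p, hp, rfl⟩
  exact ⟨aeval v p, one_mul d ▸ IsHomogeneous.aeval hp v hv, DFunLike.congr_fun hmk p⟩

theorem HilbertBound.of_comap_rename_succAbove {I : Ideal (MvPolynomial (Fin (n + 1)) ℂ)}
    {i : Fin (n + 1)} (hi : X i ∈ I) {P : Polynomial ℤ}
    (hP : HilbertBound (I.comap (rename i.succAbove :
      MvPolynomial (Fin n) ℂ →ₐ[ℂ] MvPolynomial (Fin (n + 1)) ℂ)) P) :
    HilbertBound I P := fun d =>
  (Nat.cast_le.2 ((Submodule.finrank_mono (gradedPart_le_map_rename_succAbove hi d)).trans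
    (finrank_map_homogeneousSubmodule_le _ fun _ hp _ =>
      Ideal.Quotient.eq_zero_iff_mem.2 hp))).trans (hP d)

end HilbertBound

section UpperBound

open MvPolynomial Module

variable {r n s : ℕ} {m : Fin n → ℕ}

theorem esymm_cons_succ {R : Type*} [CommSemiring R] (a : R) (t : Multiset R) (d : ℕ) :
    (a ::ₘ t).esymm (d + 1) = t.esymm (d + 1) + a * t.esymm d := by
  simp only [Multiset.esymm, Multiset.powersetCard_cons, Multiset.map_add, Multiset.sum_add,
    Multiset.map_map, Function.comp_def, Multiset.prod_cons, Multiset.sum_map_mul_left]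

theorem aeval_esymmPow {A : Type*} [CommRing A] [Algebra ℂ A] (r d : ℕ) (f : Fin n → A) :
    aeval f (esymmPow r n d) = (Finset.univ.val.map fun i => f i ^ r).esymm d := by
  simp only [esymmPow, Finset.esymm_map_val, map_sum, map_prod, map_pow, aeval_X]

theorem esymmPow_zero (r n : ℕ) : esymmPow r n 0 = 1 := by
  rw [esymmPow, Finset.powersetCard_zero, Finset.sum_singleton, Finset.prod_empty]

theorem esymmPow_eq_zero_of_lt {d : ℕ} (h : n < d) : esymmPow r n d = 0 := by
  rw [esymmPow, Finset.powersetCard_eq_empty.2 (by simpa using h), Finset.sum_empty]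

theorem esymmPow_succ (r n d : ℕ) (i : Fin (n + 1)) :
    esymmPow r (n + 1) (d + 1) = rename i.succAbove (esymmPow r n (d + 1)) +
      X i ^ r * rename i.succAbove (esymmPow r n d) := by
  rw [← aeval_X_left_apply (esymmPow r (n + 1) (d + 1))]
  simp only [rename_eq_aeval, aeval_esymmPow, Fin.univ_succAbove n i, Finset.cons_val,
    Multiset.map_cons, esymm_cons_succ, Finset.map_val, Multiset.map_map, Function.comp_def,
    Fin.coe_succAboveEmb]

/-- The ideal generated by the powers `x_i ^ m_i` and by the top `s` of the polynomials `e_d(x^r)`,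
those with `n < d + s`; letting the exponents vary makes room for an induction on the number of
variables. Also `d = 0` is allowed, so that the ideal is the unit ideal for `n < s`. -/
noncomputable def expIdeal (r : ℕ) (m : Fin n → ℕ) (s : ℕ) : Ideal (MvPolynomial (Fin n) ℂ) :=
  Ideal.span (Set.range (fun i => X i ^ m i) ∪ esymmPow r n '' {d | n < d + s})

theorem X_pow_mem_expIdeal (i : Fin n) {l : ℕ} (hl : m i ≤ l) : X i ^ l ∈ expIdeal r m s :=
  Ideal.mem_of_dvd _ (pow_dvd_pow _ hl) (Ideal.subset_span (Or.inl ⟨i, rfl⟩))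

theorem esymmPow_mem_expIdeal {d : ℕ} (h : n < d + s) : esymmPow r n d ∈ expIdeal r m s :=
  Ideal.subset_span (Or.inr ⟨d, h, rfl⟩)

theorem expIdeal_le {I : Ideal (MvPolynomial (Fin n) ℂ)} (hX : ∀ i, X i ^ m i ∈ I)
    (hesymm : ∀ d, n < d + s → esymmPow r n d ∈ I) : expIdeal r m s ≤ I := by
  refine Ideal.span_le.2 ?_
  rintro _ (⟨i, rfl⟩ | ⟨d, hd, rfl⟩)
  · exact hX i
  · exact hesymm d hd

theorem powerIdeal_eq_expIdeal {k l : ℕ} (hk : k ≤ n) :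
    powerIdeal r n k l = expIdeal r (fun _ => l) k := by
  apply le_antisymm
  · refine Ideal.span_le.2 ?_
    rintro _ (⟨i, rfl⟩ | ⟨d, ⟨hd, -⟩, rfl⟩)
    · exact X_pow_mem_expIdeal i le_rfl
    · exact esymmPow_mem_expIdeal (by lia)
  · refine expIdeal_le (fun i => Ideal.subset_span (Or.inl ⟨i, rfl⟩)) fun d hd => ?_
    rcases le_or_gt d n with hdn | hdn
    · exact Ideal.subset_span (Or.inr ⟨d, ⟨by lia, hdn⟩, rfl⟩)
    · exact esymmPow_eq_zero_of_lt (r := r) hdn ▸ zero_mem _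

theorem expIdeal_eq_top_of_lt (h : n < s) : expIdeal r m s = ⊤ :=
  (Ideal.eq_top_iff_one _).2 (esymmPow_zero r n ▸ esymmPow_mem_expIdeal (by lia))

theorem expIdeal_eq_top_of_eq_zero {i : Fin n} (hi : m i = 0) : expIdeal r m s = ⊤ :=
  (Ideal.eq_top_iff_one _).2
    (pow_zero (X i : MvPolynomial (Fin n) ℂ) ▸ X_pow_mem_expIdeal i hi.le)

/-- Repeatedly splitting off `x_i` trades one power of `x_i ^ r` for one more elementary symmetric
polynomial in the remaining variables. -/
theorem X_pow_mul_rename_esymmPow_mem {I : Ideal (MvPolynomial (Fin (n + 1)) ℂ)}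
    (hI : ∀ d, n + 1 < d + s → esymmPow r (n + 1) d ∈ I) (i : Fin (n + 1)) {j d : ℕ} (hj : j ≤ s)
    (hd : n < d + j) : X i ^ (j * r) * rename i.succAbove (esymmPow r n d) ∈ I := by
  induction j generalizing d with
  | zero => rw [esymmPow_eq_zero_of_lt (show n < d from hd), map_zero, mul_zero]; exact zero_mem _
  | succ j ih =>
    have hsplit : X i ^ ((j + 1) * r) * rename i.succAbove (esymmPow r n d) =
        X i ^ (j * r) * esymmPow r (n + 1) (d + 1) -
          X i ^ (j * r) * rename i.succAbove (esymmPow r n (d + 1)) := by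
      rw [esymmPow_succ r n d i]
      ring
    rw [hsplit]
    exact sub_mem (I.mul_mem_left _ (hI _ (by lia))) (ih (by lia) (by lia))

theorem X_pow_mul_esymmPow_mem_expIdeal {k : ℕ} (hk : k ≤ n) {i : Fin n} (hi : m i ≤ (k + 1) * r) :
    X i ^ (k * r) * esymmPow r n (n - k) ∈ expIdeal r m k := by
  obtain _ | n := n
  · exact i.elim0
  have hmem {d : ℕ} (hd : n < d + k) :
      X i ^ (k * r) * rename i.succAbove (esymmPow r n d) ∈ expIdeal r m k :=
    X_pow_mul_rename_esymmPow_mem (fun _ => esymmPow_mem_expIdeal) i le_rfl hd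
  rcases hc : n + 1 - k with _ | c
  · simpa only [esymmPow_zero, map_one] using hmem (d := 0) (by lia)
  · rw [esymmPow_succ r n c i, mul_add, ← mul_assoc, ← pow_add, ← add_one_mul]
    exact add_mem (hmem (by lia)) (Ideal.mul_mem_right _ _ (X_pow_mem_expIdeal i hi))

section

attribute [local instance] MvPolynomial.gradedAlgebra

theorem expIdeal_isHomogeneous (r : ℕ) (m : Fin n → ℕ) (s : ℕ) :
    (expIdeal r m s).IsHomogeneous (homogeneousSubmodule (Fin n) ℂ) := by
  refine Ideal.homogeneous_span _ _ ?_
  rintro _ (⟨i, rfl⟩ | ⟨d, -, rfl⟩)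
  · exact ⟨_, isHomogeneous_X_pow i _⟩
  · exact ⟨_, esymmPow_isHomogeneous r n d⟩

end

namespace HilbertBound

variable {P Q : Polynomial ℤ}

theorem expIdeal_insertNth_succ (i : Fin (n + 1)) {a s' : ℕ}
    (hP : HilbertBound (expIdeal r (i.insertNth a m : Fin (n + 1) → ℕ) s) P)
    (hQ : HilbertBound (expIdeal r m s') Q)
    (h : ∀ d, n < d + s' → X i ^ a * rename i.succAbove (esymmPow r n d) ∈
      expIdeal r (i.insertNth (a + 1) m : Fin (n + 1) → ℕ) s) :
    HilbertBound (expIdeal r (i.insertNth (a + 1) m : Fin (n + 1) → ℕ) s)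
      (P + Polynomial.X ^ a * Q) := by
  refine of_colon (expIdeal_isHomogeneous _ _ _) (isHomogeneous_X_pow i a) (hP.anti ?_)
    (of_comap_rename_succAbove (i := i) ?_ (hQ.anti ?_))
  · refine expIdeal_le ((Fin.forall_iff_succAbove i).2 ⟨?_, fun j => ?_⟩) fun d hd => ?_
    · rw [Fin.insertNth_apply_same]
      exact Ideal.mem_sup_right (Ideal.mem_span_singleton_self _)
    · rw [Fin.insertNth_apply_succAbove]
      exact Ideal.mem_sup_left (X_pow_mem_expIdeal _ (by rw [Fin.insertNth_apply_succAbove]))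
    · exact Ideal.mem_sup_left (esymmPow_mem_expIdeal hd)
  · rw [Submodule.mem_colon_singleton, smul_eq_mul, ← pow_succ']
    exact X_pow_mem_expIdeal _ (by rw [Fin.insertNth_apply_same])
  · refine expIdeal_le (fun j => ?_) fun d hd => ?_ <;>
      rw [Ideal.mem_comap, Submodule.mem_colon_singleton, smul_eq_mul, mul_comm]
    · rw [map_pow, rename_X]
      refine Ideal.mul_mem_left _ _ (X_pow_mem_expIdeal _ ?_)
      rw [Fin.insertNth_apply_succAbove]
    · exact h d hd

theorem expIdeal_insertNth (hr : 0 < r) (i : Fin (n + 1)) (hQ : HilbertBound (expIdeal r m s) Q)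
    (j : ℕ) : HilbertBound (expIdeal r (i.insertNth j m : Fin (n + 1) → ℕ) (s + 1))
      (qInt Polynomial.X j * Q) := by
  induction j with
  | zero =>
    rw [expIdeal_eq_top_of_eq_zero (i := i) (by rw [Fin.insertNth_apply_same]), qInt_zero, zero_mul]
    exact top
  | succ j ih =>
    rw [qInt_succ, add_mul]
    refine ih.expIdeal_insertNth_succ i hQ fun d hd => ?_
    have hmem : esymmPow r (n + 1) d ∈
        expIdeal r (i.insertNth (j + 1) m : Fin (n + 1) → ℕ) (s + 1) :=
      esymmPow_mem_expIdeal (by lia)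
    cases d with
    | zero =>
      rw [esymmPow_zero] at hmem ⊢
      rw [map_one]
      exact Ideal.mul_mem_left _ _ hmem
    | succ d =>
      have hsplit : X i ^ j * rename i.succAbove (esymmPow r n (d + 1)) =
          X i ^ j * esymmPow r (n + 1) (d + 1) -
            X i ^ (j + r) * rename i.succAbove (esymmPow r n d) := by
        rw [esymmPow_succ r n d i]
        ring
      rw [hsplit]
      refine sub_mem (Ideal.mul_mem_left _ _ hmem)
        (Ideal.mul_mem_right _ _ (X_pow_mem_expIdeal _ ?_))
      rw [Fin.insertNth_apply_same]
      lia

theorem expIdeal_esymmPow {k : ℕ} (hk : k ≤ n) (hm : ∀ i, m i ≤ (k + 1) * r)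
    (hP : HilbertBound (expIdeal r m (k + 1)) P)
    (hQ : HilbertBound (expIdeal r (fun _ : Fin n => k * r) k) Q) :
    HilbertBound (expIdeal r m k) (P + Polynomial.X ^ (r * (n - k)) * Q) := by
  rw [mul_comm r]
  refine of_colon (expIdeal_isHomogeneous _ _ _) (esymmPow_isHomogeneous r n (n - k))
    (hP.anti (expIdeal_le (fun i => ?_) fun d hd => ?_))
    (hQ.anti (expIdeal_le (fun i => ?_) fun d hd => ?_))
  · exact Ideal.mem_sup_left (X_pow_mem_expIdeal _ le_rfl)
  · rcases (show n - k ≤ d by lia).eq_or_lt with rfl | hd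
    · exact Ideal.mem_sup_right (Ideal.mem_span_singleton_self _)
    · exact Ideal.mem_sup_left (esymmPow_mem_expIdeal (by lia))
  · exact Submodule.mem_colon_singleton.2 (X_pow_mul_esymmPow_mem_expIdeal hk (hm i))
  · exact Submodule.mem_colon_singleton.2 (Ideal.mul_mem_right _ _ (esymmPow_mem_expIdeal hd))

end HilbertBound

theorem hilbertBound_expIdeal_const (hr : 0 < r) (n k : ℕ) :
    HilbertBound (expIdeal r (fun _ : Fin n => k * r) k) (hilbPolyS r n k) := by
  induction n generalizing k with
  | zero =>
    cases k with
    | zero => exact hilbPolyS_zero_zero r ▸ HilbertBound.one_of_isEmpty _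
    | succ k =>
      rw [expIdeal_eq_top_of_lt k.succ_pos, hilbPolyS_eq_zero_of_lt r k.succ_pos]
      exact HilbertBound.top
  | succ n ih =>
    cases k with
    | zero =>
      rw [expIdeal_eq_top_of_eq_zero (i := 0) (zero_mul r), hilbPolyS_succ_zero]
      exact HilbertBound.top
    | succ k =>
      rw [hilbPolyS_succ_succ hr,
        ← Fin.insertNth_self_removeNth (α := fun _ => ℕ) 0 fun _ : Fin (n + 1) => (k + 1) * r]
      refine HilbertBound.expIdeal_insertNth hr 0 ?_ _
      rcases le_or_gt k n with hk | hk
      · exact (ih (k + 1)).expIdeal_esymmPow hk (fun _ => le_rfl) (ih k)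
      · rw [expIdeal_eq_top_of_lt hk, hilbPolyS_eq_zero_of_lt r hk,
          hilbPolyS_eq_zero_of_lt r (hk.trans k.lt_succ_self), mul_zero, add_zero]
        exact HilbertBound.top

theorem ite_lt_eq_insertNth {α : Type*} (t : Fin (n + 1)) (a b : α) :
    (fun i : Fin (n + 1) => if i.val < t then a else b) =
      t.insertNth b fun i : Fin n => if i.val < t then a else b := by
  refine Fin.eq_insertNth_iff.2 ⟨if_neg (lt_irrefl _), funext fun i => ?_⟩
  exact if_congr (Fin.succAbove_lt_iff_castSucc_lt t i) rfl rfl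

theorem ite_lt_succ_eq_insertNth {α : Type*} (t : Fin (n + 1)) (a b : α) :
    (fun i : Fin (n + 1) => if i.val < t + 1 then a else b) =
      t.insertNth a fun i : Fin n => if i.val < t then a else b := by
  refine Fin.eq_insertNth_iff.2 ⟨if_pos (Nat.lt_succ_self _), funext fun i => if_congr ?_ rfl rfl⟩
  have hne := Fin.val_ne_of_ne (t.succAbove_ne i)
  have hlt : (t.succAbove i).val < t ↔ i.val < t := Fin.succAbove_lt_iff_castSucc_lt t i
  lia

theorem hilbertBound_expIdeal_ite {k : ℕ} {F : ℕ → Polynomial ℤ}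
    (hF : ∀ n, HilbertBound (expIdeal r (fun _ : Fin n => k * r) k) (F n)) {t : ℕ} (ht : t ≤ n) :
    HilbertBound (expIdeal r (fun i : Fin n => if i.val < t then k * r + 1 else k * r) k)
      (∑ z ∈ Finset.range (t + 1), (t.choose z : Polynomial ℤ) *
        (Polynomial.X ^ (k * r * z) * F (n - z))) := by
  induction t generalizing n with
  | zero => simpa using hF n
  | succ t ih =>
    obtain ⟨n, rfl⟩ := Nat.exists_eq_add_of_le' (t.succ_pos.trans_le ht)
    rw [Finset.sum_choose_succ_mul fun z _ => Polynomial.X ^ (k * r * z) * F (n + 1 - z)]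
    have hP := ih (show t ≤ n + 1 by lia)
    let i : Fin (n + 1) := ⟨t, by lia⟩
    rw [ite_lt_eq_insertNth i] at hP
    rw [ite_lt_succ_eq_insertNth i]
    convert hP.expIdeal_insertNth_succ i (ih (show t ≤ n by lia)) fun d hd => ?_ using 2
    · rw [Finset.mul_sum]
      refine Finset.sum_congr rfl fun z _ => ?_
      rw [Nat.add_sub_add_right]
      ring
    · exact X_pow_mul_rename_esymmPow_mem (fun _ => esymmPow_mem_expIdeal) i le_rfl hd

theorem hilbertBound_expIdeal_add_one (hr : 0 < r) (n k : ℕ) :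
    HilbertBound (expIdeal r (fun _ : Fin n => k * r + 1) k)
      (∑ z ∈ Finset.range (n + 1), (n.choose z : Polynomial ℤ) *
        Polynomial.X ^ (k * r * z) * hilbPolyS r (n - z) k) := by
  simpa only [Fin.is_lt, if_true, mul_assoc] using
    hilbertBound_expIdeal_ite (fun n => hilbertBound_expIdeal_const hr n k) le_rfl

end UpperBound

section OrbitHarmonics

open MvPolynomial Module

variable {σ K : Type*} [Field K]

/-- Restriction of polynomials to a set `Y` of points. -/
noncomputable def evalOn (Y : Set (σ → K)) : MvPolynomial σ K →ₐ[K] (Y → K) :=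
  AlgHom.pi fun y => aeval y.1

/-- The functions on `Y` given by polynomials of degree less than `d`. -/
noncomputable def degreeFiltration (Y : Set (σ → K)) (d : ℕ) : Submodule K (Y → K) :=
  ⨆ c < d, (homogeneousSubmodule σ K c).map (evalOn Y).toLinearMap

variable {Y : Set (σ → K)}

theorem evalOn_apply (p : MvPolynomial σ K) (y : Y) : evalOn Y p y = aeval y.1 p := rfl

theorem degreeFiltration_succ (Y : Set (σ → K)) (d : ℕ) : degreeFiltration Y (d + 1) =
    degreeFiltration Y d ⊔ (homogeneousSubmodule σ K d).map (evalOn Y).toLinearMap :=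
  Nat.iSup_lt_succ _ d

theorem degreeFiltration_mono (Y : Set (σ → K)) : Monotone (degreeFiltration Y) :=
  fun _ _ h => biSup_mono fun _ hc => hc.trans_le h

theorem evalOn_mem_degreeFiltration {p : MvPolynomial σ K} {c d : ℕ} (hp : p.IsHomogeneous c)
    (h : c < d) : evalOn Y p ∈ degreeFiltration Y d :=
  Submodule.mem_iSup_of_mem c (Submodule.mem_iSup_of_mem h ⟨p, hp, rfl⟩)

theorem evalOn_mul_mem_degreeFiltration {p : MvPolynomial σ K} {e d : ℕ} (hp : p.IsHomogeneous e)
    {v : Y → K} (hv : v ∈ degreeFiltration Y d) : evalOn Y p * v ∈ degreeFiltration Y (e + d) := by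
  have hle : degreeFiltration Y d ≤
      (degreeFiltration Y (e + d)).comap (LinearMap.mulLeft K (evalOn Y p)) := by
    refine iSup₂_le fun c hc => ?_
    rintro _ ⟨q, hq, rfl⟩
    have := evalOn_mem_degreeFiltration (Y := Y) (hp.mul hq) (Nat.add_lt_add_left hc e)
    rwa [map_mul] at this
  exact hle hv

theorem iSup_degreeFiltration (Y : Set (σ → K)) :
    ⨆ d, degreeFiltration Y d = LinearMap.range (evalOn Y).toLinearMap := by
  apply le_antisymm
  · exact iSup_le fun d => iSup₂_le fun c _ => LinearMap.map_le_range
  · rintro _ ⟨p, rfl⟩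
    rw [← sum_homogeneousComponent p, map_sum]
    exact Submodule.sum_mem _ fun c _ => Submodule.mem_iSup_of_mem (c + 1)
      (evalOn_mem_degreeFiltration (homogeneousComponent_isHomogeneous c p) c.lt_succ_self)

theorem exists_aeval_eq_one_and_eq_zero {x y : σ → K} (h : x ≠ y) :
    ∃ p : MvPolynomial σ K, aeval x p = (1 : K) ∧ aeval y p = (0 : K) := by
  obtain ⟨i, hi⟩ := Function.ne_iff.1 h
  refine ⟨C (x i - y i)⁻¹ * (X i - C (y i)), ?_, ?_⟩
  · simpa using inv_mul_cancel₀ (sub_ne_zero.2 hi)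
  · simp

theorem evalOn_surjective (Y : Set (σ → K)) [Finite Y] : Function.Surjective (evalOn Y) := by
  classical
  have := Fintype.ofFinite Y
  have hsep (x y : Y) : ∃ p : MvPolynomial σ K,
      aeval x.1 p = (1 : K) ∧ (y ≠ x → aeval y.1 p = (0 : K)) := by
    by_cases hxy : y = x
    · exact ⟨1, map_one _, fun hne => absurd hxy hne⟩
    · obtain ⟨p, hx, hy⟩ := exists_aeval_eq_one_and_eq_zero (Subtype.coe_ne_coe.2 (Ne.symm hxy))
      exact ⟨p, hx, fun _ => hy⟩
  choose p hp_self hp_ne using hsep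
  intro v
  refine ⟨∑ x, C (v x) * ∏ y, p x y, funext fun z => ?_⟩
  rw [evalOn_apply, map_sum, Finset.sum_eq_single z]
  · simp only [map_mul, algHom_C, map_prod, hp_self, Finset.prod_const_one, mul_one,
      Algebra.algebraMap_self, RingHom.id_apply]
  · intro x _ hx
    rw [map_mul, map_prod, Finset.prod_eq_zero (Finset.mem_univ z) (hp_ne x z hx.symm), mul_zero]
  · exact fun h => absurd (Finset.mem_univ z) h

theorem exists_degreeFiltration_eq_top (Y : Set (σ → K)) [Finite Y] :
    ∃ D₀, ∀ D ≥ D₀, degreeFiltration Y D = ⊤ := by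
  obtain ⟨D₀, hD₀⟩ := monotone_stabilizes_iff_noetherian.2
    (inferInstance : IsNoetherian K (Y → K)) ⟨degreeFiltration Y, degreeFiltration_mono Y⟩
  have hstab : ∀ D ≥ D₀, degreeFiltration Y D₀ = degreeFiltration Y D := hD₀
  have htop : degreeFiltration Y D₀ = ⊤ := by
    have hrange : LinearMap.range (evalOn Y).toLinearMap = ⊤ :=
      LinearMap.range_eq_top.2 (evalOn_surjective Y)
    rw [← hrange, ← iSup_degreeFiltration]
    exact le_antisymm (le_iSup _ D₀) (iSup_le fun D =>
      (degreeFiltration_mono Y (le_max_left D D₀)).trans (hstab _ (le_max_right D D₀)).ge)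
  exact ⟨D₀, fun D hD => (hstab D hD).symm.trans htop⟩

/-- The ideal spanned by the top-degree forms of the polynomials vanishing on `Y`: a form of degree
`d` belongs to it if and only if it agrees on `Y` with a polynomial of degree less than `d`. -/
noncomputable def leadingIdeal (Y : Set (σ → K)) : Ideal (MvPolynomial σ K) where
  carrier := {p | ∀ d, evalOn Y (homogeneousComponent d p) ∈ degreeFiltration Y d}
  add_mem' hp hq d := by
    rw [map_add, map_add]
    exact add_mem (hp d) (hq d)
  zero_mem' d := by
    rw [map_zero, map_zero]
    exact zero_mem _
  smul_mem' a p hp d := by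
    rw [smul_eq_mul, ← sum_homogeneousComponent a, Finset.sum_mul, map_sum, map_sum]
    refine Submodule.sum_mem _ fun e _ => ?_
    have ha := homogeneousComponent_isHomogeneous e a
    rcases lt_or_ge d e with hd | hd
    · rw [homogeneousComponent_mul_of_lt ha p hd, map_zero]
      exact zero_mem _
    · obtain ⟨c, rfl⟩ := Nat.exists_eq_add_of_le' hd
      rw [homogeneousComponent_add_mul ha, map_mul, add_comm c e]
      exact evalOn_mul_mem_degreeFiltration ha (hp c)

theorem mem_leadingIdeal_iff {p : MvPolynomial σ K} {d : ℕ} (hp : p.IsHomogeneous d) :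
    p ∈ leadingIdeal Y ↔ evalOn Y p ∈ degreeFiltration Y d := by
  refine ⟨fun h => homogeneousComponent_eq_self hp ▸ h d, fun h e => ?_⟩
  rw [homogeneousComponent_of_mem hp]
  split_ifs with he
  · exact he ▸ h
  · rw [map_zero]
    exact zero_mem _

theorem mem_leadingIdeal_of_sum_eq_zero {f : ℕ → MvPolynomial σ K} {w : ℕ} (hw : 0 < w)
    (hf : ∀ j, (f j).IsHomogeneous (j * w)) {c : ℕ → K} {d : ℕ} (hc : c d = 1)
    (h : ∀ y ∈ Y, ∑ j ∈ Finset.range (d + 1), c j * aeval y (f j) = 0) : f d ∈ leadingIdeal Y := by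
  refine (mem_leadingIdeal_iff (hf d)).2 ?_
  have hfd : evalOn Y (f d) = -∑ j ∈ Finset.range d, c j • evalOn Y (f j) := by
    ext y
    have hy := h y y.2
    rw [Finset.sum_range_succ, hc, one_mul, add_comm] at hy
    simpa only [evalOn_apply, Pi.neg_apply, Finset.sum_apply, Pi.smul_apply, smul_eq_mul]
      using eq_neg_of_add_eq_zero_left hy
  rw [hfd]
  refine neg_mem (Submodule.sum_mem _ fun j hj => Submodule.smul_mem _ _ ?_)
  exact evalOn_mem_degreeFiltration (hf j)
    (Nat.mul_lt_mul_of_pos_right (Finset.mem_range.1 hj) hw)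

theorem X_pow_card_mem_leadingIdeal {B : Finset K} {i : σ} (hB : ∀ y ∈ Y, y i ∈ B) :
    X i ^ B.card ∈ leadingIdeal Y := by
  let Q : Polynomial K := ∏ b ∈ B, (Polynomial.X - Polynomial.C b)
  have hmonic : Q.Monic := Polynomial.monic_prod_X_sub_C _ B
  have hdeg : Q.natDegree = B.card := Polynomial.natDegree_finsetProd_X_sub_C_eq_card B _
  refine mem_leadingIdeal_of_sum_eq_zero (f := fun j => X i ^ j) (c := Q.coeff) one_pos
    (fun j => (mul_one j).symm ▸ isHomogeneous_X_pow i j) (hdeg ▸ hmonic) fun y hy => ?_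
  simp only [map_pow, aeval_X]
  rw [← hdeg, ← Polynomial.eval_eq_sum_range, Polynomial.eval_prod]
  exact Finset.prod_eq_zero (hB y hy) (by simp)

end OrbitHarmonics

section OrbitHarmonicsBound

open MvPolynomial Module

variable {n : ℕ} {I : Ideal (MvPolynomial (Fin n) ℂ)} {Y : Set (Fin n → ℂ)}

theorem finrank_degreeFiltration_le [Finite Y] (hI : I ≤ leadingIdeal Y) (D : ℕ) :
    finrank ℂ (degreeFiltration Y D) ≤ ∑ d ∈ Finset.range D, finrank ℂ (gradedPart I d) := by
  induction D with
  | zero =>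
    have : degreeFiltration Y 0 = ⊥ := by simp [degreeFiltration]
    rw [this, finrank_bot]
    exact Nat.zero_le _
  | succ D ih =>
    let mkQ := (degreeFiltration Y D).mkQ
    have hmap : (degreeFiltration Y (D + 1)).map mkQ =
        (homogeneousSubmodule (Fin n) ℂ D).map (mkQ ∘ₗ (evalOn Y).toLinearMap) := by
      rw [degreeFiltration_succ, Submodule.map_sup, Submodule.mkQ_map_self, bot_sup_eq,
        Submodule.map_comp]
    have hgr : finrank ℂ ((degreeFiltration Y (D + 1)).map mkQ) ≤
        finrank ℂ (gradedPart I D) := by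
      rw [hmap]
      refine finrank_map_homogeneousSubmodule_le _ fun p hp hD => ?_
      exact (Submodule.Quotient.mk_eq_zero _).2 ((mem_leadingIdeal_iff hD).1 (hI hp))
    have hadd := finrank_le_finrank_map_add (degreeFiltration Y (D + 1)) (degreeFiltration Y D) mkQ
      fun v _ hv => (Submodule.Quotient.mk_eq_zero _).1 hv
    rw [Finset.sum_range_succ]
    lia

theorem HilbertBound.eq_coeff {P : Polynomial ℤ} (hP : HilbertBound I P) [Finite Y]
    (hI : I ≤ leadingIdeal Y) (hcard : P.eval 1 ≤ Nat.card Y) (d : ℕ) :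
    (finrank ℂ (gradedPart I d) : ℤ) = P.coeff d := by
  have := Fintype.ofFinite Y
  obtain ⟨D₀, hD₀⟩ := exists_degreeFiltration_eq_top Y
  set D := D₀ + (P.natDegree + 1) + (d + 1)
  have hpoints := finrank_degreeFiltration_le hI D
  rw [hD₀ D (by lia), finrank_top, finrank_fintype_fun_eq_card, ← Nat.card_eq_fintype_card]
    at hpoints
  have heval : P.eval 1 = ∑ c ∈ Finset.range D, P.coeff c := by
    rw [Polynomial.eval_eq_sum_range' (show P.natDegree < D by lia)]
    simp only [one_pow, mul_one]
  have hsum : ∑ c ∈ Finset.range D, (finrank ℂ (gradedPart I c) : ℤ) =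
      ∑ c ∈ Finset.range D, P.coeff c := by
    refine le_antisymm (Finset.sum_le_sum fun c _ => hP c) (heval ▸ hcard.trans ?_)
    exact_mod_cast hpoints
  exact (Finset.sum_eq_sum_iff_of_le fun c _ => hP c).1 hsum d (Finset.mem_range.2 (by lia))

/-- The generating series `∏ (1 + a X)` of the elementary symmetric functions of a multiset `s`. -/
noncomputable def esymmSeries {R : Type*} [CommSemiring R] (s : Multiset R) : PowerSeries R :=
  (s.map fun a => 1 + PowerSeries.C a * PowerSeries.X).prod

theorem esymmSeries_add {R : Type*} [CommSemiring R] (s t : Multiset R) :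
    esymmSeries (s + t) = esymmSeries s * esymmSeries t := by
  rw [esymmSeries, Multiset.map_add, Multiset.prod_add, esymmSeries, esymmSeries]

theorem coeff_esymmSeries {R : Type*} [CommSemiring R] (s : Multiset R) (d : ℕ) :
    PowerSeries.coeff d (esymmSeries s) = s.esymm d := by
  induction s using Multiset.induction generalizing d with
  | empty => cases d <;> simp [esymmSeries, Multiset.esymm, PowerSeries.coeff_one,
      Multiset.powersetCard_zero_right]
  | cons a s ih =>
    rw [esymmSeries, Multiset.map_cons, Multiset.prod_cons, ← esymmSeries, add_mul, one_mul,
      mul_assoc, map_add, PowerSeries.coeff_C_mul, ih]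
    cases d with
    | zero => simp [Multiset.esymm]
    | succ d => rw [PowerSeries.coeff_succ_X_mul, ih, esymm_cons_succ]

theorem constantCoeff_esymmSeries {R : Type*} [CommSemiring R] (s : Multiset R) :
    PowerSeries.constantCoeff (esymmSeries s) = 1 := by
  simp [← PowerSeries.coeff_zero_eq_constantCoeff_apply, coeff_esymmSeries, Multiset.esymm]

theorem exists_sum_mul_esymm_add_eq_esymm {R : Type*} [CommRing R] (s : Multiset R) :
    ∃ c : ℕ → R, c 0 = 1 ∧
      ∀ t d, ∑ j ∈ Finset.range (d + 1), c (d - j) * (s + t).esymm j = t.esymm d := by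
  refine ⟨fun j => PowerSeries.coeff j (PowerSeries.invOfUnit (esymmSeries s) 1), by simp,
    fun t d => ?_⟩
  have ht : esymmSeries t = esymmSeries (s + t) * PowerSeries.invOfUnit (esymmSeries s) 1 := by
    rw [esymmSeries_add, mul_right_comm,
      PowerSeries.mul_invOfUnit _ 1 (constantCoeff_esymmSeries s), one_mul]
  rw [← coeff_esymmSeries t, ht, PowerSeries.coeff_mul,
    Finset.Nat.sum_antidiagonal_eq_sum_range_succ_mk]
  exact Finset.sum_congr rfl fun j _ => by rw [mul_comm, coeff_esymmSeries]

theorem esymmPow_mem_leadingIdeal {r d : ℕ} (hr : 0 < r) {A : Finset ℂ} (hd : n < d + A.card)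
    (hA : ∀ y ∈ Y, ∀ a ∈ A, ∃ i, y i ^ r = a) : esymmPow r n d ∈ leadingIdeal Y := by
  obtain ⟨c, hc, hsum⟩ := exists_sum_mul_esymm_add_eq_esymm A.val
  refine mem_leadingIdeal_of_sum_eq_zero hr (esymmPow_isHomogeneous r n) (c := fun j => c (d - j))
    (by rw [Nat.sub_self, hc]) fun y hy => ?_
  have hle : A.val ≤ Finset.univ.val.map fun i => y i ^ r :=
    (Multiset.le_iff_subset A.nodup).2 fun a ha => by simpa using hA y hy a ha
  obtain ⟨t, ht⟩ := Multiset.le_iff_exists_add.1 hle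
  have hcard := congr_arg Multiset.card ht
  rw [Multiset.card_map, Multiset.card_add, Finset.card_val, Finset.card_univ, Fintype.card_fin,
    Finset.card_val] at hcard
  simp only [aeval_esymmPow, ht, hsum]
  rw [Multiset.esymm, Multiset.powersetCard_eq_empty d (by lia), Multiset.map_zero,
    Multiset.sum_zero]

theorem expIdeal_le_leadingIdeal {r : ℕ} (hr : 0 < r) {A B : Finset ℂ} (hB : ∀ y ∈ Y, ∀ i, y i ∈ B)
    (hA : ∀ y ∈ Y, ∀ a ∈ A, ∃ i, y i ^ r = a) :
    expIdeal r (fun _ : Fin n => B.card) A.card ≤ leadingIdeal Y :=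
  expIdeal_le (fun i => X_pow_card_mem_leadingIdeal fun y hy => hB y hy i)
    fun _ hd => esymmPow_mem_leadingIdeal hr hd hA

end OrbitHarmonicsBound

section Counting

open fwdDiff Finset

theorem filter_piFinset_not_exists {ι β : Type*} [Fintype ι] [DecidableEq ι] (B : Finset β)
    (p : β → Prop) [DecidablePred p] :
    {w ∈ Fintype.piFinset fun _ : ι => B | ¬∃ i, p (w i)} =
      Fintype.piFinset fun _ : ι => {b ∈ B | ¬p b} := by
  ext w
  simp only [mem_filter, Fintype.mem_piFinset, not_exists, forall_and]

section Words

variable {ι β κ : Type*} [Fintype ι] [DecidableEq ι] [DecidableEq κ] (φ : β → κ)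

theorem card_words_covering_insert_add (A : Finset κ) (B : Finset β) (a : κ) :
    #{w ∈ Fintype.piFinset fun _ : ι => B | ∀ a' ∈ insert a A, ∃ i, φ (w i) = a'} +
        #{w ∈ Fintype.piFinset fun _ : ι => {b ∈ B | ¬φ b = a} | ∀ a' ∈ A, ∃ i, φ (w i) = a'} =
      #{w ∈ Fintype.piFinset fun _ : ι => B | ∀ a' ∈ A, ∃ i, φ (w i) = a'} := by
  simp only [forall_mem_insert]
  rw [← filter_piFinset_not_exists B fun b => φ b = a, ← filter_filter, filter_comm,
    filter_comm fun w : ι → β => ¬∃ i, φ (w i) = a]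
  exact card_filter_add_card_filter_not _

theorem card_words_covering {r : ℕ} (A : Finset κ) (B : Finset β)
    (hφ : ∀ a ∈ A, #{b ∈ B | φ b = a} = r) :
    (#{w ∈ Fintype.piFinset fun _ : ι => B | ∀ a ∈ A, ∃ i, φ (w i) = a} : ℤ) =
      Δ_[(r : ℤ)] ^[#A] (fun x => x ^ Fintype.card ι) (#B - r * #A) := by
  induction A using Finset.induction generalizing B with
  | empty => simp [Fintype.card_piFinset]
  | insert a A ha ih =>
    have hA : ∀ a' ∈ A, #{b ∈ B | φ b = a'} = r := fun a' ha' => hφ a' (mem_insert_of_mem ha')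
    have hcard : (#{b ∈ B | ¬φ b = a} : ℤ) = #B - r := by
      have := card_filter_add_card_filter_not (s := B) fun b => φ b = a
      rw [hφ a (mem_insert_self a A)] at this
      lia
    have havoid : (#{w ∈ Fintype.piFinset fun _ : ι => {b ∈ B | ¬φ b = a} |
        ∀ a' ∈ A, ∃ i, φ (w i) = a'} : ℤ) =
        Δ_[(r : ℤ)] ^[#A] (fun x => x ^ Fintype.card ι) (#B - r - r * #A) := by
      rw [ih _ fun a' ha' => ?_, hcard]
      rw [← hA a' ha', filter_filter]
      refine congr_arg _ (filter_congr fun b _ => and_iff_right_of_imp ?_)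
      rintro rfl rfl
      exact ha ha'
    have hinsert := card_words_covering_insert_add (ι := ι) φ A B a
    rw [card_insert_of_notMem ha, Function.iterate_succ_apply', fwdDiff]
    push_cast
    rw [show (#B : ℤ) - r * (#A + 1) + r = #B - r * #A by ring, ← ih B hA,
      show (#B : ℤ) - r * (#A + 1) = #B - r - r * #A by ring, ← havoid]
    lia

end Words

end Counting

section Conclusion

open MvPolynomial Module fwdDiff Finset

variable {r : ℕ}

theorem finrank_gradedPart_expIdeal (hr : 0 < r) {n : ℕ} {A B : Finset ℂ}
    (hAB : ∀ a ∈ A, #{b ∈ B | b ^ r = a} = r) {P : Polynomial ℤ}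
    (hP : HilbertBound (expIdeal r (fun _ : Fin n => #B) #A) P)
    (hcard : P.eval 1 = Δ_[(r : ℤ)] ^[#A] (fun x => x ^ n) (#B - r * #A)) (d : ℕ) :
    (finrank ℂ (gradedPart (expIdeal r (fun _ : Fin n => #B) #A) d) : ℤ) = P.coeff d := by
  let Y : Finset (Fin n → ℂ) :=
    {w ∈ Fintype.piFinset fun _ : Fin n => B | ∀ a ∈ A, ∃ i, w i ^ r = a}
  have hY (y) : y ∈ (Y : Set (Fin n → ℂ)) ↔ (∀ i, y i ∈ B) ∧ ∀ a ∈ A, ∃ i, y i ^ r = a := by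
    rw [mem_coe, mem_filter, Fintype.mem_piFinset]
  refine hP.eq_coeff (Y := Y) (expIdeal_le_leadingIdeal hr (fun y hy => ((hY y).1 hy).1)
    fun y hy => ((hY y).1 hy).2) ?_ d
  have hwords := card_words_covering (ι := Fin n) (fun b : ℂ => b ^ r) A B hAB
  rw [Fintype.card_fin, ← hcard] at hwords
  rw [Nat.card_coe_set_eq, Set.ncard_coe_finset]
  exact hwords.ge.trans_eq (by congr!)

theorem card_nthRootsFinset {K : Type*} [Field K] [IsAlgClosed K] [NeZero (r : K)] {a : K}
    (ha : a ≠ 0) : #(Polynomial.nthRootsFinset r a) = r := by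
  classical
  have : NeZero r := .of_neZero_natCast K
  obtain ⟨ζ, hζ⟩ := HasEnoughRootsOfUnity.exists_primitiveRoot K r
  rw [Polynomial.nthRootsFinset_def, Multiset.toFinset_card_of_nodup (hζ.nthRoots_nodup ha),
    hζ.card_nthRoots, if_pos (IsAlgClosed.exists_pow_nat_eq a (NeZero.pos r))]

theorem exists_card_fiber_pow_eq {K : Type*} [Field K] [IsAlgClosed K] [DecidableEq K]
    [NeZero (r : K)] {A : Finset K} (hA : 0 ∉ A) :
    ∃ B : Finset K, #B = #A * r ∧ 0 ∉ B ∧ ∀ a ∈ A, #{b ∈ B | b ^ r = a} = r := by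
  have hr : 0 < r := have : NeZero r := .of_neZero_natCast K; NeZero.pos r
  let B : Finset K := A.biUnion fun a => Polynomial.nthRootsFinset r a
  have hB (b : K) : b ∈ B ↔ b ^ r ∈ A := by
    simp [B, Polynomial.mem_nthRootsFinset hr]
  have hfiber : ∀ a ∈ A, #{b ∈ B | b ^ r = a} = r := by
    intro a ha
    have : {b ∈ B | b ^ r = a} = Polynomial.nthRootsFinset r a := by
      ext b
      rw [mem_filter, hB, Polynomial.mem_nthRootsFinset hr, and_iff_right_of_imp fun h => h ▸ ha]
    rw [this, card_nthRootsFinset (ne_of_mem_of_not_mem ha hA)]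
  refine ⟨B, ?_, by rwa [hB, zero_pow hr.ne'], hfiber⟩
  rw [card_eq_sum_card_fiberwise fun b hb => (hB b).1 hb, sum_congr rfl hfiber, sum_const,
    smul_eq_mul]

theorem exists_notMem_card_eq {α : Type*} [Infinite α] (a : α) (k : ℕ) :
    ∃ A : Finset α, a ∉ A ∧ #A = k := by
  obtain ⟨A, hA, hk⟩ := (Set.finite_singleton a).infinite_compl.exists_subset_card_eq k
  exact ⟨A, fun ha => hA ha rfl, hk⟩

theorem hilbS_eq (hr : 0 < r) {n k : ℕ} (hk : k ≤ n) :
    hilbS r n k = (hilbPolyS r n k : PowerSeries ℤ) := by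
  have : NeZero r := .of_pos hr
  obtain ⟨A, hA, rfl⟩ := exists_notMem_card_eq (0 : ℂ) k
  obtain ⟨B, hB, -, hAB⟩ := exists_card_fiber_pow_eq (r := r) hA
  have hP := hilbertBound_expIdeal_const hr n #A
  rw [← hB] at hP
  ext d
  rw [hilbS, hilbertSeries, PowerSeries.coeff_mk, Polynomial.coeff_coe]
  change (finrank ℂ (gradedPart (powerIdeal r n #A (#A * r)) d) : ℤ) = _
  rw [powerIdeal_eq_expIdeal hk, ← hB]
  refine finrank_gradedPart_expIdeal hr hAB hP ?_ d
  rw [eval_one_hilbPolyS hr, hB, Nat.cast_mul, mul_comm, sub_self]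

theorem hilbR_eq (hr : 0 < r) {n k : ℕ} (hk : k ≤ n) :
    hilbR r n k = ((∑ z ∈ range (n + 1), (n.choose z : Polynomial ℤ) *
      Polynomial.X ^ (k * r * z) * hilbPolyS r (n - z) k : Polynomial ℤ) : PowerSeries ℤ) := by
  have : NeZero r := .of_pos hr
  obtain ⟨A, hA, rfl⟩ := exists_notMem_card_eq (0 : ℂ) k
  obtain ⟨B, hB, hB0, hAB⟩ := exists_card_fiber_pow_eq (r := r) hA
  have hcard : #(insert 0 B) = #A * r + 1 := by rw [card_insert_of_notMem hB0, hB]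
  have hfiber : ∀ a ∈ A, #{b ∈ insert 0 B | b ^ r = a} = r := by
    intro a ha
    rw [filter_insert, zero_pow hr.ne', if_neg (ne_of_mem_of_not_mem ha hA).symm, hAB a ha]
  have hP := hilbertBound_expIdeal_add_one hr n #A
  rw [← hcard] at hP
  ext d
  rw [hilbR, hilbertSeries, PowerSeries.coeff_mk, Polynomial.coeff_coe]
  change (finrank ℂ (gradedPart (powerIdeal r n #A (#A * r + 1)) d) : ℤ) = _
  rw [powerIdeal_eq_expIdeal hk, ← hcard]
  refine finrank_gradedPart_expIdeal hr hfiber hP ?_ d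
  have hpoint : (#(insert 0 B) : ℤ) - r * #A = 0 + 1 := by
    rw [hcard]
    push_cast
    ring
  rw [hpoint, fwdDiff_iter_pow_add_one]
  simp [Polynomial.eval_finsetSum, eval_one_hilbPolyS hr]

end Conclusion

end WreathCoinvariant

theorem mainTheorem5_general (r n k : ℕ) (hr : 0 < r) (hk : k ≤ n) :
    (WreathCoinvariant.hilbR r n k =
      ((∑ z ∈ Finset.range (n + 1),
        (n.choose z : Polynomial ℤ) * Polynomial.X ^ (k * r * z) *
          Polynomial.reverse
            (WreathCoinvariant.qInt (Polynomial.X : Polynomial ℤ) r ^ (n - z) *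
              WreathCoinvariant.qFactorial (Polynomial.X ^ r : Polynomial ℤ) k *
              WreathCoinvariant.qStirling (Polynomial.X ^ r : Polynomial ℤ) (n - z) k) :
        Polynomial ℤ) : PowerSeries ℤ)) ∧
    (WreathCoinvariant.hilbR r n k =
      ((∑ z ∈ Finset.range (n + 1),
        (n.choose z : Polynomial ℤ) * Polynomial.X ^ (k * r * z) *
          WreathCoinvariant.qInt (Polynomial.X : Polynomial ℤ) r ^ (n - z) *
            WreathCoinvariant.qFactorial (Polynomial.X ^ r : Polynomial ℤ) k *
            Polynomial.reverse
              (WreathCoinvariant.qStirling (Polynomial.X ^ r : Polynomial ℤ) (n - z) k) :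
        Polynomial ℤ) : PowerSeries ℤ)) ∧
    (WreathCoinvariant.hilbS r n k =
      ((Polynomial.reverse
          (WreathCoinvariant.qInt (Polynomial.X : Polynomial ℤ) r ^ n *
            WreathCoinvariant.qFactorial (Polynomial.X ^ r : Polynomial ℤ) k *
            WreathCoinvariant.qStirling (Polynomial.X ^ r : Polynomial ℤ) n k) :
        Polynomial ℤ) : PowerSeries ℤ)) ∧
    (WreathCoinvariant.hilbS r n k =
      ((WreathCoinvariant.qInt (Polynomial.X : Polynomial ℤ) r ^ n *
          WreathCoinvariant.qFactorial (Polynomial.X ^ r : Polynomial ℤ) k *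
          Polynomial.reverse
            (WreathCoinvariant.qStirling (Polynomial.X ^ r : Polynomial ℤ) n k) :
        Polynomial ℤ) : PowerSeries ℤ)) := by
  have hS := WreathCoinvariant.hilbS_eq hr hk
  have hR := WreathCoinvariant.hilbR_eq hr hk
  simp only [WreathCoinvariant.reverse_eq_hilbPolyS hr]
  exact ⟨hR, by simpa only [WreathCoinvariant.hilbPolyS, mul_assoc] using hR, hS, hS⟩

theorem mainTheorem5 (r n k : ℕ) (hr : 2 ≤ r) (hn : 1 ≤ n) (hk : k ≤ n) :
    (WreathCoinvariant.hilbR r n k =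
      ((∑ z ∈ Finset.range (n + 1),
        (n.choose z : Polynomial ℤ) * Polynomial.X ^ (k * r * z) *
          Polynomial.reverse
            (WreathCoinvariant.qInt (Polynomial.X : Polynomial ℤ) r ^ (n - z) *
              WreathCoinvariant.qFactorial (Polynomial.X ^ r : Polynomial ℤ) k *
              WreathCoinvariant.qStirling (Polynomial.X ^ r : Polynomial ℤ) (n - z) k) :
        Polynomial ℤ) : PowerSeries ℤ)) ∧
    (WreathCoinvariant.hilbR r n k =
      ((∑ z ∈ Finset.range (n + 1),
        (n.choose z : Polynomial ℤ) * Polynomial.X ^ (k * r * z) *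
          WreathCoinvariant.qInt (Polynomial.X : Polynomial ℤ) r ^ (n - z) *
            WreathCoinvariant.qFactorial (Polynomial.X ^ r : Polynomial ℤ) k *
            Polynomial.reverse
              (WreathCoinvariant.qStirling (Polynomial.X ^ r : Polynomial ℤ) (n - z) k) :
        Polynomial ℤ) : PowerSeries ℤ)) ∧
    (WreathCoinvariant.hilbS r n k =
      ((Polynomial.reverse
          (WreathCoinvariant.qInt (Polynomial.X : Polynomial ℤ) r ^ n *
            WreathCoinvariant.qFactorial (Polynomial.X ^ r : Polynomial ℤ) k *
            WreathCoinvariant.qStirling (Polynomial.X ^ r : Polynomial ℤ) n k) :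
        Polynomial ℤ) : PowerSeries ℤ)) ∧
    (WreathCoinvariant.hilbS r n k =
      ((WreathCoinvariant.qInt (Polynomial.X : Polynomial ℤ) r ^ n *
          WreathCoinvariant.qFactorial (Polynomial.X ^ r : Polynomial ℤ) k *
          Polynomial.reverse
            (WreathCoinvariant.qStirling (Polynomial.X ^ r : Polynomial ℤ) n k) :
        Polynomial ℤ) : PowerSeries ℤ)) :=
  mainTheorem5_general r n k (by lia) hk
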